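/- **Corollary 3.1.** Let $G_{\mathbb C}$ be a connected complex Lie group with Lie algebra $\mathfrak g_{\mathbb C}$, and let $\sigma,\tau$ be commuting antiholomorphic involutive automorphisms of $G_{\mathbb C}$ such that the fixed point group $U=G_{\mathbb C}^{\tau}$ is compact (for instance: $G_{\mathbb C}$ a connected complex reductive algebraic group, $\sigma$ defining a real form, and $\tau$ a compact real form commuting with $\sigma$). Put $G=G_{\mathbb C}^{\sigma}$, let $\theta=\tau\sigma=\sigma\tau$ be the Cartan involution, and let $K=G^{\theta}$ be the subgroup of $\theta$-fixed points of $G$. Suppose that $\theta$ is inner: there is $k_0\in K$ such that $\theta=\mathrm{Ad}(k_0)$ on $\mathfrak g_{\mathbb C}$. Let $(\pi,V)$ be a finite-dimensional holomorphic complex representation of $G_{\mathbb C}$, regarded also as a representation of $G$. Then: 1. $\pi(k_0)$ intertwines $\pi$ and $\pi^\theta=\pi\circ\theta$, that is, $\pi(k_0)\,\pi(g)=\pi(\theta g)\,\pi(k_0)$ for all $g\in G_{\mathbb C}$ (in particular for all $g\in G$). 2. $V$ admits a nondegenerate $G$-invariant hermitian form $\langle\cdot,\cdot\rangle$. Such a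 form can be obtained from $\pi(k_0)$: there are a positive definite $U$-invariant hermitian form $\langle\cdot,\cdot\rangle_u$ on $V$ and a linear automorphism $S$ of $V$ commuting with $\pi(G_{\mathbb C})$ (a scalar if $V$ is irreducible) such that $\langle v,w\rangle=\langle Tv,w\rangle_u$ for all $v,w\in V$, where $T=S\,\pi(k_0)$. -/

import Mathlib

open scoped Manifold ContDiff ComplexConjugate

noncomputable section

namespace InnerCartan

section Groups

variable (E : Type*) [NormedAddCommGroup E] [NormedSpace ℂ E]
variable {GC : Type*} [TopologicalSpace GC] [ChartedSpace E GC]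

/-- The real differential of `f` at `x`, the tangent spaces at `x` and `f x` being the model
space `E`. -/
def realDifferential (f : GC → GC) (x : GC) : E →L[ℝ] E :=
  mfderiv 𝓘(ℝ, E) 𝓘(ℝ, E) f x

/-- A map of a complex manifold (modelled on `E`) to itself is antiholomorphic if it is smooth as
a map of real manifolds and all its differentials are conjugate-linear. -/
def IsAntiholomorphic (f : GC → GC) : Prop :=
  ContMDiff 𝓘(ℝ, E) 𝓘(ℝ, E) ∞ f ∧
    ∀ (x : GC) (X : E),
      realDifferential E f x (Complex.I • X) = -(Complex.I • realDifferential E f x X)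

variable [Group GC]

/-- An antiholomorphic involution of a complex Lie group: an antiholomorphic group homomorphism
which is its own inverse. -/
structure IsAntiholomorphicInvolution (σ : GC →* GC) : Prop where
  antiholomorphic : IsAntiholomorphic E σ
  involutive : Function.Involutive σ

/-- The group `G = GC^σ` of fixed points of `σ`. -/
def fixedPoints (σ : GC →* GC) : Subgroup GC := σ.eqLocus (MonoidHom.id GC)

/-- The Cartan involution `θ = τ ∘ σ`. -/
def cartanInvolution (σ τ : GC →* GC) : GC →* GC := τ.comp σ

/-- The subgroup `K` of `G = GC^σ` of points fixed by the Cartan involution; its Lie algebra is the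
`+1`-eigenspace of `θ` on the Lie algebra of `G`, and `G = K exp 𝔰`. -/
def maximalCompact (σ τ : GC →* GC) : Subgroup GC :=
  fixedPoints σ ⊓ fixedPoints (cartanInvolution σ τ)

/-- The differential at the identity of an endomorphism of the complex Lie group, acting on the
complex Lie algebra. -/
def lieDifferential (θ : GC →* GC) (X : GroupLieAlgebra 𝓘(ℂ, E) GC) :
    GroupLieAlgebra 𝓘(ℂ, E) GC :=
  (mfderiv 𝓘(ℂ, E) 𝓘(ℂ, E) θ (1 : GC) X : E)

/-- The adjoint action: `Ad k` is the differential at the identity of conjugation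
`g ↦ k g k⁻¹`. -/
def Ad (k : GC) (X : GroupLieAlgebra 𝓘(ℂ, E) GC) : GroupLieAlgebra 𝓘(ℂ, E) GC :=
  lieDifferential E (MulAut.conj k).toMonoidHom X

/-- A finite-dimensional representation of a complex Lie group is holomorphic if all its matrix
coefficients are holomorphic functions on the group. -/
def IsHolomorphicRep {V : Type*} [AddCommGroup V] [Module ℂ V]
    (π : Representation ℂ GC V) : Prop :=
  ∀ (v : V) (l : Module.Dual ℂ V), MDifferentiable 𝓘(ℂ, E) 𝓘(ℂ, ℂ) fun g : GC => l (π g v)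

end Groups

section Forms

variable {V : Type*} [AddCommGroup V] [Module ℂ V]

/-- A sesquilinear form (conjugate-linear in the first variable) is hermitian if
`conj (B v w) = B w v`. -/
def IsHermitianForm (B : V →ₗ⋆[ℂ] V →ₗ[ℂ] ℂ) : Prop := ∀ v w, conj (B v w) = B w v

/-- A positive definite hermitian form. -/
def IsPosDefForm (B : V →ₗ⋆[ℂ] V →ₗ[ℂ] ℂ) : Prop :=
  IsHermitianForm B ∧ ∀ v, v ≠ 0 → 0 < (B v v).re

/-- Invariance of a form under all `π h` with `h` in the subgroup `H`. -/
def IsInvariantForm {GC : Type*} [Group GC] (H : Subgroup GC) (π : Representation ℂ GC V)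
    (B : V →ₗ⋆[ℂ] V →ₗ[ℂ] ℂ) : Prop :=
  ∀ h ∈ H, ∀ v w, B (π h v) (π h w) = B v w

end Forms

end InnerCartan

end

/-!
Both parts rest on the same observation: on a connected complex Lie group, a map whose differential
vanishes everywhere is constant (`eq_of_hasMFDerivAt_zero`), and for maps built from group
homomorphisms it suffices to compute the differential at `1`, the other points being reached by
translation. Neither the exponential map nor the closed subgroup theorem is needed.

*Intertwining.* `θ = τσ` is holomorphic, as a composition of two conjugate-linear differentials is
complex linear. If two endomorphisms `φ, ψ` of `G_ℂ` have the same differential at `1`, then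
`φ / ψ` has zero differential, so `φ = ψ` (`monoidHom_eq_of_hasMFDerivAt_one`). Applied to `θ` and
conjugation by `k₀`, this gives `θ g = k₀ g k₀⁻¹` on all of `G_ℂ`, and `π k₀` intertwines `π` with
`π ∘ θ`.

*Unitarian trick.* Averaging over Haar measure of the compact group `U` gives a positive definite
`U`-invariant form `h` (`exists_invariant_posDefForm`). Then `h (π (τ g) v) (π g w) = h v w` for all
`g` in `G_ℂ` (`IsPosDefForm.involution_apply`): the left side is holomorphic in `g` and constant on
`U`, and the tangent space of `U` at `1` contains the real form of fixed vectors of `dτ`. The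
last point is `exists_fixed_curve`: the average `½ ((y - z) + A (f y - z))` linearizes an involution
`f` near a fixed point `z`, so every fixed vector of its differential `A` is tangent to a curve of
fixed points.

*The form.* On `G = G_ℂ^σ` one has `θ = τ`, so for every automorphism `S` commuting with `π` the form
`B v w = h (S (π k₀ v)) w` is `G`-invariant and nondegenerate. It remains to make it hermitian.
Since `θ² = 1`, the `h`-unitary operator `π k₀ ^ 2` commutes with `π`; take for `S` a unitary inverse
square root of it, given by the continuous functional calculus
(`exists_commute_isSelfAdjoint_mul`). Then `S π(k₀)` is a unitary involution, hence self-adjoint.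
-/

namespace InnerCartan

open scoped Topology
open MeasureTheory Filter

/-! ### Inverse square roots of unitary operators -/

theorem finite_spectrum_of_finiteDimensional {A : Type*} [Ring A] [Algebra ℂ A]
    [FiniteDimensional ℂ A] (a : A) : (spectrum ℂ a).Finite := by
  have hint : IsIntegral ℂ a := IsIntegral.of_finite ℂ a
  refine ((minpoly ℂ a).rootSet_finite ℂ).subset fun x hx => ?_
  rw [Polynomial.mem_rootSet]
  refine ⟨minpoly.ne_zero hint, ?_⟩
  have h := spectrum.subset_polynomial_aeval a (minpoly ℂ a) ⟨x, hx, rfl⟩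
  rw [minpoly.aeval] at h
  have : Nontrivial A := by
    by_contra hA
    rw [not_nontrivial_iff_subsingleton] at hA
    simp [spectrum.of_subsingleton] at hx
  rw [spectrum.zero_eq] at h
  simpa [Polynomial.aeval_def] using h

/-- A unitary `T` becomes self-adjoint after multiplication by a unitary inverse square root `S` of
`T ^ 2` lying in the double commutant of `T ^ 2`, because then `S * T` is a unitary involution. -/
theorem exists_commute_isSelfAdjoint_mul {A : Type*} [CStarAlgebra A] [FiniteDimensional ℂ A]
    {T : A} (hT : T ∈ unitary A) :
    ∃ S ∈ unitary A, (∀ a, Commute (T * T) a → Commute S a) ∧ IsSelfAdjoint (S * T) := by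
  have hz : T * T ∈ unitary A := mul_mem hT hT
  set z := T * T with hz_def
  -- The spectrum is finite, so every function is continuous on it, and no branch of the square root
  -- has to be chosen continuously.
  have hcont (f : ℂ → ℂ) : ContinuousOn f (spectrum ℂ z) :=
    (finite_spectrum_of_finiteDimensional z).continuousOn f
  have hnorm : ∀ x ∈ spectrum ℂ z, ‖x‖ = 1 := fun x hx => by
    simpa using spectrum.subset_circle_of_unitary hz hx
  have hn : IsStarNormal z := ⟨by
    rw [commute_iff_eq, Unitary.star_mul_self_of_mem hz, Unitary.mul_star_self_of_mem hz]⟩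
  choose r hr using fun x : ℂ => IsAlgClosed.exists_eq_mul_self x⁻¹
  have hSz : cfc r z * cfc r z * z = 1 := by
    nth_rewrite 3 [← cfc_id' ℂ z]
    rw [← cfc_mul r r z (hcont _) (hcont _), ← cfc_mul _ _ z (hcont _) (hcont _), ← cfc_one ℂ z]
    refine cfc_congr fun x hx => ?_
    have hx0 : x ≠ 0 := norm_ne_zero_iff.1 (by rw [hnorm x hx]; exact one_ne_zero)
    simp [← hr, hx0]
  have hS : cfc r z ∈ unitary A := by
    rw [cfc_unitary_iff r z hn (hcont _)]
    intro x hx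
    have h1 : ‖r x‖ = 1 := by
      have := congrArg norm (hr x)
      rw [norm_inv, hnorm x hx, inv_one, norm_mul] at this
      nlinarith [norm_nonneg (r x)]
    rw [Complex.star_def, mul_comm, Complex.mul_conj, Complex.normSq_eq_norm_sq, h1]
    simp
  have hcomm : ∀ a, Commute z a → Commute (cfc r z) a := fun a ha => by
    refine Commute.cfc ha ?_ r
    have h1 : star z * (z * a) * star z = star z * (a * z) * star z := by rw [ha.eq]
    rw [← mul_assoc, Unitary.star_mul_self_of_mem hz, one_mul, mul_assoc, mul_assoc,
      Unitary.mul_star_self_of_mem hz, mul_one] at h1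
    exact h1.symm
  refine ⟨cfc r z, hS, hcomm, ?_⟩
  have hST : Commute (cfc r z) T := hcomm T ((Commute.refl T).mul_left (Commute.refl T))
  have hsq : (cfc r z * T) * (cfc r z * T) = 1 := by
    calc (cfc r z * T) * (cfc r z * T) = cfc r z * (T * cfc r z) * T := by simp only [mul_assoc]
      _ = cfc r z * cfc r z * z := by rw [← hST.eq, hz_def]; simp only [mul_assoc]
      _ = 1 := hSz
  have hM : cfc r z * T ∈ unitary A := mul_mem hS hT
  rw [isSelfAdjoint_iff]
  calc star (cfc r z * T) = star (cfc r z * T) * ((cfc r z * T) * (cfc r z * T)) := by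
        rw [hsq, mul_one]
    _ = cfc r z * T := by rw [← mul_assoc, Unitary.star_mul_self_of_mem hM, one_mul]

/-- `exists_commute_isSelfAdjoint_mul` for the linear isometry `T` of a finite-dimensional inner
product space. -/
theorem exists_linearEquiv_commute_symmetric {V : Type*} [NormedAddCommGroup V]
    [InnerProductSpace ℂ V] [FiniteDimensional ℂ V] (T : V →ₗ[ℂ] V)
    (hT : ∀ v w, inner ℂ (T v) (T w) = inner ℂ v w) :
    ∃ S : V ≃ₗ[ℂ] V,
      (∀ f : V →ₗ[ℂ] V, (∀ v, f (T (T v)) = T (T (f v))) → ∀ v, S (f v) = f (S v)) ∧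
      ∀ v w, inner ℂ (S (T v)) w = inner ℂ v (S (T w)) := by
  have : CompleteSpace V := FiniteDimensional.complete ℂ V
  have : FiniteDimensional ℂ (V →L[ℂ] V) :=
    LinearMap.toContinuousLinearMap.finiteDimensional
  let T' : V →L[ℂ] V := LinearMap.toContinuousLinearMap T
  have h1 : star T' * T' = 1 := by
    ext v
    refine ext_inner_right ℂ fun w => ?_
    change inner ℂ (T'.adjoint (T' v)) w = inner ℂ v w
    rw [ContinuousLinearMap.adjoint_inner_left]
    exact hT v w
  have h2 : T' * star T' = 1 := by
    have h3 : (T' : V →ₗ[ℂ] V) * ((star T' : V →L[ℂ] V) : V →ₗ[ℂ] V) = 1 :=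
      mul_eq_one_comm.1 (LinearMap.ext fun v => DFunLike.congr_fun h1 v)
    ext v
    exact DFunLike.congr_fun h3 v
  obtain ⟨S, hS, hcomm, hsa⟩ := exists_commute_isSelfAdjoint_mul (T := T') ⟨h1, h2⟩
  refine ⟨LinearEquiv.ofLinearMap (S : V →ₗ[ℂ] V) (star S : V →L[ℂ] V) ?_ ?_, ?_, ?_⟩
  · ext v
    exact DFunLike.congr_fun (Unitary.mul_star_self_of_mem hS) v
  · ext v
    exact DFunLike.congr_fun (Unitary.star_mul_self_of_mem hS) v
  · intro f hf v
    have := hcomm (LinearMap.toContinuousLinearMap f) (by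
      ext v; exact (hf v).symm)
    exact DFunLike.congr_fun this.eq v
  · intro v w
    have := (ContinuousLinearMap.isSelfAdjoint_iff_isSymmetric.1 hsa) v w
    exact this

/-! ### Positive definite forms -/

section Forms
variable {V : Type*} [AddCommGroup V] [Module ℂ V]

/-- The inner product on `V` given by a positive definite hermitian form. Both are conjugate-linear
in the first variable. -/
@[reducible]
def IsPosDefForm.innerCore {h : V →ₗ⋆[ℂ] V →ₗ[ℂ] ℂ} (hh : IsPosDefForm h) :
    InnerProductSpace.Core ℂ V where
  inner v w := h v w
  conj_inner_symm v w := hh.1 w v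
  re_inner_nonneg v := by
    rcases eq_or_ne v 0 with rfl | hv
    · simp
    · exact (hh.2 v hv).le
  add_left u v w := by simp
  smul_left v w c := by simp
  definite v hv := by
    by_contra hne
    have := hh.2 v hne
    rw [hv] at this
    simp at this

theorem exists_isPosDefForm [FiniteDimensional ℂ V] :
    ∃ h : V →ₗ⋆[ℂ] V →ₗ[ℂ] ℂ, IsPosDefForm h := by
  let e : V ≃ₗ[ℂ] EuclideanSpace ℂ (Fin (Module.finrank ℂ V)) :=
    LinearEquiv.ofFinrankEq _ _ (by simp)
  refine ⟨LinearMap.mk₂'ₛₗ (starRingEnd ℂ) (RingHom.id ℂ) (fun v w => (inner ℂ (e v) (e w) : ℂ))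
    (fun u v w => by rw [map_add, inner_add_left])
    (fun c v w => by rw [map_smul, inner_smul_left, smul_eq_mul])
    (fun u v w => by rw [map_add, inner_add_right])
    (fun c v w => by rw [map_smul, inner_smul_right, RingHom.id_apply, smul_eq_mul]),
    fun v w => ?_, fun v hv => ?_⟩
  · exact inner_conj_symm (e w) (e v)
  · have : e v ≠ 0 := by simpa using hv
    rw [LinearMap.mk₂'ₛₗ_apply]
    exact (pow_pos (norm_pos_iff.2 this) 2).trans_eq (inner_self_eq_norm_sq (𝕜 := ℂ) (e v)).symm

theorem IsPosDefForm.exists_linearEquiv [FiniteDimensional ℂ V] {h : V →ₗ⋆[ℂ] V →ₗ[ℂ] ℂ}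
    (hh : IsPosDefForm h) (T : V →ₗ[ℂ] V) (hT : ∀ v w, h (T v) (T w) = h v w) :
    ∃ S : V ≃ₗ[ℂ] V,
      (∀ f : V →ₗ[ℂ] V, (∀ v, f (T (T v)) = T (T (f v))) → ∀ v, S (f v) = f (S v)) ∧
      ∀ v w, h (S (T v)) w = h v (S (T w)) := by
  let := hh.innerCore.toNormedAddCommGroup
  let := InnerProductSpace.ofCore hh.innerCore.toCore
  exact exists_linearEquiv_commute_symmetric T hT

/-- Schur's lemma. -/
theorem exists_eq_smul_of_isIrreducible [FiniteDimensional ℂ V] {G : Type*} [Group G]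
    {π : Representation ℂ G V} (hirr : π.IsIrreducible) (S : V →ₗ[ℂ] V)
    (hS : ∀ (g : G) (v : V), S (π g v) = π g (S v)) : ∃ c : ℂ, ∀ v, S v = c • v := by
  obtain ⟨c, hc⟩ :=
    (Representation.IsIrreducible.algebraMap_intertwiningMap_bijective_of_isAlgClosed (ρ := π)).2
      ⟨S, fun g => LinearMap.ext fun v => hS g v⟩
  refine ⟨c, fun v => ?_⟩
  have := DFunLike.congr_fun hc v
  simpa [Algebra.algebraMap_eq_smul_one] using this.symm

end Forms

/-- Weyl's averaging argument: a positive definite form is integrated over Haar measure of the compact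
subgroup `U`. -/
theorem exists_invariant_posDefForm {V : Type*} [AddCommGroup V] [Module ℂ V]
    {G : Type*} [Group G] [TopologicalSpace G] [IsTopologicalGroup G] (π : Representation ℂ G V)
    (hπ : ∀ (v : V) (l : Module.Dual ℂ V), Continuous fun g => l (π g v))
    (U : Subgroup G) (hU : IsCompact (U : Set G))
    [FiniteDimensional ℂ V] :
    ∃ h : V →ₗ⋆[ℂ] V →ₗ[ℂ] ℂ, IsPosDefForm h ∧ IsInvariantForm U π h := by
  obtain ⟨h₀, hh₀⟩ := exists_isPosDefForm (V := V)
  have : CompactSpace U := isCompact_iff_compactSpace.1 hU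
  let : MeasurableSpace U := borel U
  have : BorelSpace U := ⟨rfl⟩
  let μ : Measure U := Measure.haar
  -- The inverse turns left invariance of the Haar measure into invariance of the averaged form.
  let F (v w : V) (u : U) : ℂ := h₀ (π (u⁻¹ : U) v) (π (u⁻¹ : U) w)
  have hcont (v w : V) : Continuous (F v w) := by
    let b := Module.finBasis ℂ V
    have hF : F v w = fun u : U => ∑ i, ∑ j, conj (b.coord i (π (u⁻¹ : U) v)) *
        (b.coord j (π (u⁻¹ : U) w) * h₀ (b i) (b j)) := by
      funext u
      simp only [F]
      conv_lhs => rw [← b.sum_repr (π (u⁻¹ : U) v), ← b.sum_repr (π (u⁻¹ : U) w)]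
      simp only [map_sum, LinearMap.sum_apply, map_smulₛₗ, LinearMap.smul_apply, smul_eq_mul,
        RingHom.id_apply, Module.Basis.coord_apply, Finset.mul_sum]
      rw [Finset.sum_comm]
      exact Finset.sum_congr rfl fun i _ => Finset.sum_congr rfl fun j _ => by ring
    have hc (x : V) (i) : Continuous fun u : U => b.coord i (π (u⁻¹ : U) x) :=
      (hπ x (b.coord i)).comp (continuous_subtype_val.comp continuous_inv)
    rw [hF]
    exact continuous_finsetSum _ fun i _ => continuous_finsetSum _ fun j _ =>
      (Complex.continuous_conj.comp (hc v i)).mul ((hc w j).mul continuous_const)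
  have hint (v w : V) : Integrable (F v w) μ :=
    (hcont v w).integrable_of_hasCompactSupport (HasCompactSupport.of_compactSpace _)
  let h : V →ₗ⋆[ℂ] V →ₗ[ℂ] ℂ := LinearMap.mk₂'ₛₗ (starRingEnd ℂ) (RingHom.id ℂ)
    (fun v w => ∫ u, F v w u ∂μ)
    (fun v v' w => by
      rw [← integral_add (hint _ _) (hint _ _)]
      simp [F])
    (fun c v w => by
      rw [smul_eq_mul, ← integral_const_mul]
      simp [F])
    (fun v w w' => by
      rw [← integral_add (hint _ _) (hint _ _)]
      simp [F])
    (fun c v w => by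
      rw [RingHom.id_apply, smul_eq_mul, ← integral_const_mul]
      simp [F])
  refine ⟨h, ⟨fun v w => ?_, fun v hv => ?_⟩, fun g hg v w => ?_⟩
  · change conj (∫ u, F v w u ∂μ) = ∫ u, F w v u ∂μ
    rw [← integral_conj]
    exact integral_congr_ae (.of_forall fun u => hh₀.1 _ _)
  · change 0 < (∫ u, F v v u ∂μ).re
    have hre : (∫ u, F v v u ∂μ).re = ∫ u, (F v v u).re ∂μ :=
      (integral_re (𝕜 := ℂ) (hint v v)).symm
    have hpos (u : U) : 0 < (F v v u).re := by
      refine hh₀.2 _ fun h0 => hv ?_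
      have := congrArg (π (u : G)) h0
      rwa [← Module.End.mul_apply, ← map_mul, Subgroup.coe_inv, mul_inv_cancel, map_one, map_zero]
        at this
    rw [hre]
    exact (Complex.continuous_re.comp (hcont v v)).integral_pos_of_hasCompactSupport_nonneg_nonzero
      (x := 1) (HasCompactSupport.of_compactSpace _) (fun u => (hpos u).le) (hpos 1).ne'
  · change ∫ u, F (π g v) (π g w) u ∂μ = ∫ u, F v w u ∂μ
    rw [← integral_mul_left_eq_self (F v w) (⟨g, hg⟩⁻¹ : U)]
    refine integral_congr_ae (.of_forall fun u => ?_)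
    simp [F, mul_inv_rev, map_mul]

/-! ### Fixed points of an involution near a given fixed point -/

/-- If `f` is an involution near its fixed point `z`, every vector fixed by the differential of `f`
at `z` is tangent to a curve of fixed points of `f`. -/
theorem exists_fixed_curve {E : Type*} [NormedAddCommGroup E] [NormedSpace ℝ E] [CompleteSpace E]
    {f : E → E} {z : E} {A : E →L[ℝ] E} (hf : HasStrictFDerivAt f A z) (hz : f z = z)
    (hinv : ∀ᶠ y in 𝓝 z, f (f y) = y) {X : E} (hX : A X = X) :
    ∃ c : ℝ → E, c 0 = z ∧ HasDerivAt c X 0 ∧ ∀ᶠ t in 𝓝 0, f (c t) = c t := by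
  have hAA : A.comp A = ContinuousLinearMap.id ℝ E := by
    have h1 : HasFDerivAt (fun y => f (f y)) (A.comp A) z :=
      HasFDerivAt.comp z (by rw [hz]; exact hf.hasFDerivAt) hf.hasFDerivAt
    exact h1.unique ((hasFDerivAt_id z).congr_of_eventuallyEq hinv)
  have hAA' (x : E) : A (A x) = x := DFunLike.congr_fun hAA x
  -- `ψ` conjugates `f` to its linear part `A`, and its differential at `z` is the identity.
  let ψ : E → E := fun y => (1 / 2 : ℝ) • ((y - z) + A (f y - z))
  have hψz : ψ z = 0 := by simp [ψ, hz]
  have hψ : HasStrictFDerivAt ψ ((ContinuousLinearEquiv.refl ℝ E : E ≃L[ℝ] E) : E →L[ℝ] E) z := by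
    have h1 : HasStrictFDerivAt ψ
        ((1 / 2 : ℝ) • (ContinuousLinearMap.id ℝ E + A.comp A)) z :=
      (((hasStrictFDerivAt_id z).sub_const z).add
        (A.hasStrictFDerivAt.comp z (hf.sub_const z))).const_smul _
    convert h1 using 1
    rw [hAA]
    ext x
    simp [← add_smul]
    norm_num
  have hψf : ∀ᶠ y in 𝓝 z, ψ (f y) = A (ψ y) := by
    filter_upwards [hinv] with y hy
    simp only [ψ, map_smul, map_add, hAA', hy]
    rw [add_comm]
  let χ : E → E := hψ.localInverse
  have hχ : HasStrictFDerivAt χ _ _ := hψ.to_localInverse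
  have hl : ∀ᶠ y in 𝓝 z, χ (ψ y) = y := hψ.eventually_left_inverse
  have hr : ∀ᶠ y in 𝓝 (ψ z), ψ (χ y) = y := hψ.eventually_right_inverse
  have hχz : χ (ψ z) = z := hψ.localInverse_apply_image
  rw [hψz] at hχ hr hχz
  have hline : HasDerivAt (fun t : ℝ => t • X) X 0 := by
    simpa using (hasDerivAt_id (0 : ℝ)).smul_const X
  have hder : HasDerivAt (fun t : ℝ => χ (t • X)) X 0 := by
    have := HasFDerivAt.comp_hasDerivAt (0 : ℝ) (l := χ) (f := fun t : ℝ => t • X)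
      (by simpa using hχ.hasFDerivAt) hline
    simpa [Function.comp_def] using this
  have h0 : χ ((0 : ℝ) • X) = z := by rw [zero_smul, hχz]
  refine ⟨fun t => χ (t • X), h0, hder, ?_⟩
  have hc : Tendsto (fun t : ℝ => χ (t • X)) (𝓝 0) (𝓝 z) := by
    have := hder.continuousAt.tendsto
    simpa only [h0] using this
  have hfc : Tendsto (fun t : ℝ => f (χ (t • X))) (𝓝 0) (𝓝 z) := by
    have := hf.continuousAt.tendsto.comp hc
    rwa [hz] at this
  have hX0 : Tendsto (fun t : ℝ => t • X) (𝓝 0) (𝓝 0) := by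
    simpa using hline.continuousAt.tendsto
  filter_upwards [hc.eventually hψf, hfc.eventually hl, hX0.eventually hr] with t h1 h2 h3
  rw [← h2, h1, h3, map_smul, hX]

/-! ### Derivatives of maps between manifolds -/

section Scalars
variable {E : Type*} [NormedAddCommGroup E] [NormedSpace ℂ E]
  {F : Type*} [NormedAddCommGroup F] [NormedSpace ℂ F]
  {M : Type*} [TopologicalSpace M] [ChartedSpace E M]
  {N : Type*} [TopologicalSpace N] [ChartedSpace F N]

/-- A manifold modelled on a complex normed space `E` is also one over `ℝ`, with the same charts. -/
theorem hasMFDerivAt_restrictScalars {f : M → N} {x : M} {f' : E →L[ℂ] F}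
    (hf : HasMFDerivAt 𝓘(ℂ, E) 𝓘(ℂ, F) f x f') :
    HasMFDerivAt 𝓘(ℝ, E) 𝓘(ℝ, F) f x (f'.restrictScalars ℝ : E →L[ℝ] F) :=
  ⟨hf.1, HasFDerivWithinAt.restrictScalars ℝ hf.2⟩

theorem hasMFDerivAt_of_restrictScalars {f : M → N} {x : M} {f' : E →L[ℂ] F}
    (hf : HasMFDerivAt 𝓘(ℝ, E) 𝓘(ℝ, F) f x (f'.restrictScalars ℝ : E →L[ℝ] F)) :
    HasMFDerivAt 𝓘(ℂ, E) 𝓘(ℂ, F) f x f' :=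
  ⟨hf.1, HasFDerivWithinAt.of_restrictScalars ℝ hf.2 rfl⟩

theorem eq_of_hasMFDerivAt_zero [IsManifold 𝓘(ℂ, E) ω M] [IsManifold 𝓘(ℂ, F) ω N]
    [PreconnectedSpace M] {f : M → N}
    (hf : ∀ x, HasMFDerivAt 𝓘(ℂ, E) 𝓘(ℂ, F) f x (0 : E →L[ℂ] F)) (x y : M) : f x = f y := by
  have : IsManifold 𝓘(ℂ, E) 1 M := .of_le (n := ω) le_top
  have : IsManifold 𝓘(ℂ, F) 1 N := .of_le (n := ω) le_top
  refine IsLocallyConstant.apply_eq_of_preconnectedSpace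
    ((IsLocallyConstant.iff_eventually_eq f).2 fun x => ?_) x y
  let φ := extChartAt 𝓘(ℂ, E) x
  let ψ := extChartAt 𝓘(ℂ, F) (f x)
  let s : Set E := φ.target ∩ φ.symm ⁻¹' (f ⁻¹' ψ.source)
  have hs : s ∈ 𝓝 (φ x) := by
    refine inter_mem (extChartAt_target_mem_nhds x) ?_
    refine (continuousAt_extChartAt_symm x).preimage_mem_nhds ?_
    rw [extChartAt_to_inv]
    exact (hf x).continuousAt.preimage_mem_nhds (extChartAt_source_mem_nhds (f x))
  obtain ⟨r, hr, hball⟩ := Metric.mem_nhds_iff.1 hs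
  have hder : ∀ z ∈ s, HasFDerivAt (ψ ∘ f ∘ φ.symm) (0 : E →L[ℂ] F) z := by
    intro z hz
    have h1 : MDifferentiableAt 𝓘(ℂ, E) 𝓘(ℂ, E) φ.symm z := by
      have := mdifferentiableWithinAt_extChartAt_symm (I := 𝓘(ℂ, E)) hz.1
      rwa [modelWithCornersSelf_coe, Set.range_id, mdifferentiableWithinAt_univ] at this
    have h2 : MDifferentiableAt 𝓘(ℂ, F) 𝓘(ℂ, F) ψ (f (φ.symm z)) :=
      mdifferentiableAt_extChartAt (by simpa [ψ] using hz.2)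
    have h3 := h2.hasMFDerivAt.comp z ((hf (φ.symm z)).comp z h1.hasMFDerivAt)
    rw [hasMFDerivAt_iff_hasFDerivAt] at h3
    refine HasFDerivAt.congr_fderiv h3 (ContinuousLinearMap.ext fun v => ?_)
    exact map_zero (mfderiv 𝓘(ℂ, F) 𝓘(ℂ, F) ψ (f (φ.symm z)))
  have hconst : ∀ z ∈ Metric.ball (φ x) r, (ψ ∘ f ∘ φ.symm) z = (ψ ∘ f ∘ φ.symm) (φ x) := by
    intro z hz
    refine Metric.isOpen_ball.is_const_of_fderiv_eq_zero (𝕜 := ℂ)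
      (convex_ball _ _).isPreconnected
      (fun w hw => (hder w (hball hw)).differentiableAt.differentiableWithinAt)
      (fun w hw => (hder w (hball hw)).fderiv) hz (Metric.mem_ball_self hr)
  filter_upwards [extChartAt_source_mem_nhds (I := 𝓘(ℂ, E)) x,
    (continuousAt_extChartAt (I := 𝓘(ℂ, E)) x).preimage_mem_nhds (Metric.ball_mem_nhds _ hr)]
    with y hy hyb
  have h1 := hconst _ hyb
  have hy' : φ.symm (φ y) = y := φ.left_inv hy
  have hx' : φ.symm (φ x) = x := extChartAt_to_inv x
  simp only [Function.comp_apply] at h1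
  have hy2 : f y ∈ ψ.source := by
    have := (hball hyb).2
    rwa [Set.mem_preimage, Set.mem_preimage, hy'] at this
  rw [hx'] at h1
  change ψ (f (φ.symm (φ y))) = _ at h1
  rw [hy'] at h1
  exact ψ.injOn hy2 (mem_extChartAt_source (f x)) h1

end Scalars

/-- For a map to a normed space, the derivative on the manifold is that of its expression in the
chart at the point. -/
theorem hasMFDerivAt_iff_hasFDerivAt_chart {𝕜 : Type*} [NontriviallyNormedField 𝕜]
    {E : Type*} [NormedAddCommGroup E] [NormedSpace 𝕜 E]
    {F : Type*} [NormedAddCommGroup F] [NormedSpace 𝕜 F]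
    {M : Type*} [TopologicalSpace M] [ChartedSpace E M] {f : M → F} {x : M} {f' : E →L[𝕜] F} :
    HasMFDerivAt 𝓘(𝕜, E) 𝓘(𝕜, F) f x f' ↔
      ContinuousAt f x ∧ HasFDerivAt (f ∘ (chartAt E x).symm) f' (chartAt E x x) := by
  rw [← hasFDerivWithinAt_univ]
  unfold HasMFDerivAt
  simp only [modelWithCornersSelf_coe, Set.range_id]
  rfl

/-! ### Endomorphisms of complex Lie groups -/

section LieGroup

variable {E : Type*} [NormedAddCommGroup E] [NormedSpace ℂ E]
  {G : Type*} [TopologicalSpace G] [ChartedSpace E G]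

theorem IsAntiholomorphic.hasMFDerivAt {f : G → G} (hf : IsAntiholomorphic E f) (x : G) :
    HasMFDerivAt 𝓘(ℝ, E) 𝓘(ℝ, E) f x (realDifferential E f x) :=
  (hf.1.mdifferentiable (by simp) x).hasMFDerivAt

variable [Group G]

/-- An endomorphism of a connected complex Lie group is determined by its differential at `1`. -/
theorem monoidHom_eq_of_hasMFDerivAt_one [LieGroup 𝓘(ℂ, E) ω G] [PreconnectedSpace G]
    {φ ψ : G →* G} {A : E →L[ℂ] E}
    (hφ : HasMFDerivAt 𝓘(ℂ, E) 𝓘(ℂ, E) φ (1 : G) A)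
    (hψ : HasMFDerivAt 𝓘(ℂ, E) 𝓘(ℂ, E) ψ (1 : G) A) : φ = ψ := by
  have : IsManifold 𝓘(ℂ, E) ω G := LieGroup.toContMDiffMul.toIsManifold
  let d : G × G → G := fun p => p.1 / p.2
  have hd : MDifferentiable (𝓘(ℂ, E).prod 𝓘(ℂ, E)) 𝓘(ℂ, E) d :=
    (contMDiff_fst.div (n := ω) contMDiff_snd).mdifferentiable (by simp)
  let L : E × E →L[ℂ] E := mfderiv (𝓘(ℂ, E).prod 𝓘(ℂ, E)) 𝓘(ℂ, E) d (1, 1)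
  have hL : HasMFDerivAt (𝓘(ℂ, E).prod 𝓘(ℂ, E)) 𝓘(ℂ, E) d ((1, 1) : G × G) L :=
    (hd (1, 1)).hasMFDerivAt
  -- Division is constant on the diagonal; this replaces the formula `(X, Y) ↦ X - Y` for `L`.
  have hdiag : ∀ X : E, L (X, X) = 0 := by
    have h1 := HasMFDerivAt.comp (1 : G) (f := fun x : G => (x, x)) hL
      ((hasMFDerivAt_id (1 : G)).prodMk (hasMFDerivAt_id (1 : G)))
    have h2 : d ∘ (fun x : G => (x, x)) = fun _ => 1 := funext fun x => div_self' x
    rw [h2] at h1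
    have h3 := hasMFDerivAt_unique h1 (hasMFDerivAt_const (1 : G) (1 : G))
    exact fun X => DFunLike.congr_fun h3 X
  have hq : HasMFDerivAt 𝓘(ℂ, E) 𝓘(ℂ, E) (fun x => φ x / ψ x) (1 : G) (0 : E →L[ℂ] E) := by
    have h1 := HasMFDerivAt.comp (1 : G) (f := fun x : G => (φ x, ψ x)) (g := d) (g' := L)
      (by rw [map_one, map_one]; exact hL) (hφ.prodMk hψ)
    have h2 : (L.comp (A.prod A) : E →L[ℂ] E) = 0 := ContinuousLinearMap.ext fun X => hdiag (A X)
    rw [← h2]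
    exact h1
  -- `φ x / ψ x` arises from its values near `1` by the translations
  -- `φ g * (φ (g⁻¹ * x) / ψ (g⁻¹ * x)) * (ψ g)⁻¹`.
  have hf (g : G) :
      HasMFDerivAt 𝓘(ℂ, E) 𝓘(ℂ, E) (fun x => φ x / ψ x) g (0 : E →L[ℂ] E) := by
    have hs : MDifferentiableAt 𝓘(ℂ, E) 𝓘(ℂ, E) (fun x : G => g⁻¹ * x) g :=
      (contMDiff_mul_left (n := ω)).mdifferentiable (by simp) g
    have ht : MDifferentiable 𝓘(ℂ, E) 𝓘(ℂ, E) (fun x : G => φ g * x * (ψ g)⁻¹) :=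
      ((contMDiff_mul_right (n := ω)).comp contMDiff_mul_left).mdifferentiable (by simp)
    have hqs := HasMFDerivAt.comp g (g := fun x => φ x / ψ x) (g' := (0 : E →L[ℂ] E))
      (by rw [inv_mul_cancel]; exact hq) hs.hasMFDerivAt
    have h1 := (ht _).hasMFDerivAt.comp g hqs
    have h2 : (fun x : G => φ g * x * (ψ g)⁻¹) ∘ (fun x => φ x / ψ x) ∘ (fun x => g⁻¹ * x) =
        fun x => φ x / ψ x := by
      funext x
      simp only [Function.comp_apply, map_mul, map_inv, div_eq_mul_inv, mul_inv_rev]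
      group
    rw [h2] at h1
    have h3 (B : E →L[ℂ] E) (C : E →L[ℂ] E) : B.comp ((0 : E →L[ℂ] E).comp C) = 0 := by simp
    exact (h3 _ _) ▸ h1
  ext x
  have := eq_of_hasMFDerivAt_zero hf x 1
  simpa [div_eq_one] using this

/-- The composition of two antiholomorphic homomorphisms is holomorphic at `1`. -/
theorem exists_hasMFDerivAt_cartanInvolution {σ τ : G →* G} (hσ : IsAntiholomorphic E σ)
    (hτ : IsAntiholomorphic E τ) :
    ∃ A : E →L[ℂ] E, HasMFDerivAt 𝓘(ℂ, E) 𝓘(ℂ, E) (cartanInvolution σ τ) (1 : G) A := by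
  let S : E →L[ℝ] E := realDifferential E σ (1 : G)
  let T : E →L[ℝ] E := realDifferential E τ (1 : G)
  have hI (X : E) : T (S (Complex.I • X)) = Complex.I • T (S X) := by
    rw [show S (Complex.I • X) = -(Complex.I • S X) from hσ.2 1 X, map_neg,
      show T (Complex.I • S X) = -(Complex.I • T (S X)) from hτ.2 1 _, neg_neg]
  let A : E →L[ℂ] E :=
    { toFun := fun X => T (S X)
      map_add' := fun X Y => by rw [map_add, map_add]
      map_smul' := fun c X => by
        have hc : c • X = c.re • X + c.im • (Complex.I • X) := by
          conv_lhs => rw [← Complex.re_add_im c, add_smul, mul_smul]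
          simp
        have hc' : c • T (S X) = c.re • T (S X) + c.im • (Complex.I • T (S X)) := by
          conv_lhs => rw [← Complex.re_add_im c, add_smul, mul_smul]
          simp
        rw [RingHom.id_apply, hc, hc', map_add, map_add, map_smul, map_smul, map_smul, map_smul,
          hI]
      cont := T.continuous.comp S.continuous }
  refine ⟨A, hasMFDerivAt_of_restrictScalars ?_⟩
  exact HasMFDerivAt.comp (1 : G) (g := τ) (g' := T)
    (by rw [map_one]; exact hτ.hasMFDerivAt 1) (hσ.hasMFDerivAt 1)

/-- If the Cartan involution agrees with `Ad k` on the Lie algebra, it is conjugation by `k` on the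
group. -/
theorem cartanInvolution_eq_conj [LieGroup 𝓘(ℂ, E) ω G] [PreconnectedSpace G] {σ τ : G →* G}
    (hσ : IsAntiholomorphic E σ) (hτ : IsAntiholomorphic E τ) {k : G}
    (hk : ∀ X : GroupLieAlgebra 𝓘(ℂ, E) G, lieDifferential E (cartanInvolution σ τ) X = Ad E k X) :
    cartanInvolution σ τ = (MulAut.conj k).toMonoidHom := by
  obtain ⟨A, hA⟩ := exists_hasMFDerivAt_cartanInvolution hσ hτ
  have hconj : HasMFDerivAt 𝓘(ℂ, E) 𝓘(ℂ, E) (MulAut.conj k).toMonoidHom (1 : G)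
      (mfderiv 𝓘(ℂ, E) 𝓘(ℂ, E) (MulAut.conj k).toMonoidHom (1 : G)) := by
    have h : MDifferentiable 𝓘(ℂ, E) 𝓘(ℂ, E) (fun x : G => k * x * k⁻¹) :=
      ((contMDiff_mul_right (n := ω)).comp contMDiff_mul_left).mdifferentiable (by simp)
    exact (h 1).hasMFDerivAt
  refine monoidHom_eq_of_hasMFDerivAt_one hA ?_
  have hAd : A = (mfderiv 𝓘(ℂ, E) 𝓘(ℂ, E) (MulAut.conj k).toMonoidHom (1 : G) : E →L[ℂ] E) := by
    refine ContinuousLinearMap.ext fun X => ?_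
    have h1 := hk X
    unfold Ad lieDifferential at h1
    rw [hA.mfderiv] at h1
    exact h1
  rw [hAd]
  exact hconj

/-! ### Holomorphic representations and the unitarian trick -/

/-- Matrix coefficients are holomorphic by definition; in finite dimension so are the orbit maps. -/
theorem IsHolomorphicRep.mdifferentiable {V : Type*} [NormedAddCommGroup V] [NormedSpace ℂ V]
    [FiniteDimensional ℂ V] {π : Representation ℂ G V} (hπ : IsHolomorphicRep E π) (v : V) :
    MDifferentiable 𝓘(ℂ, E) 𝓘(ℂ, V) fun g => π g v := by
  intro x
  let b := Module.finBasis ℂ V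
  let D (i) : E →L[ℂ] ℂ := mfderiv 𝓘(ℂ, E) 𝓘(ℂ, ℂ) (fun g => b.coord i (π g v)) x
  have hb (i) : HasMFDerivAt 𝓘(ℂ, E) 𝓘(ℂ, ℂ) (fun g => b.coord i (π g v)) x (D i) :=
    (hπ v (b.coord i) x).hasMFDerivAt
  have hsum : (fun g => π g v) = fun g => ∑ i, b.coord i (π g v) • b i := by
    funext g
    exact (b.sum_repr _).symm
  rw [hsum]
  refine HasMFDerivAt.mdifferentiableAt (f' := (∑ i, (D i).smulRight (b i) : E →L[ℂ] V)) ?_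
  rw [hasMFDerivAt_iff_hasFDerivAt_chart]
  refine ⟨tendsto_finsetSum _ fun i _ => (hb i).1.smul continuousAt_const, ?_⟩
  have h (i) := (hasMFDerivAt_iff_hasFDerivAt_chart.1 (hb i)).2
  exact HasFDerivAt.fun_sum fun i _ => (h i).smul_const (b i)

/-- If `π` is unitary on the fixed points of `τ`, then `π (τ g)` is the inverse adjoint of `π g` for
every `g` in the complex group. -/
theorem inner_involution_apply [FiniteDimensional ℂ E] [LieGroup 𝓘(ℂ, E) ω G]
    [PreconnectedSpace G] {τ : G →* G} (hτ : IsAntiholomorphicInvolution E τ)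
    {V : Type*} [NormedAddCommGroup V] [InnerProductSpace ℂ V]
    [FiniteDimensional ℂ V] {π : Representation ℂ G V} (hπ : IsHolomorphicRep E π)
    (hinv : ∀ u ∈ fixedPoints τ, ∀ v w, inner ℂ (π u v) (π u w) = inner ℂ v w)
    (g : G) (v w : V) : inner ℂ (π (τ g) v) (π g w) = inner ℂ v w := by
  have : IsManifold 𝓘(ℂ, E) ω G := LieGroup.toContMDiffMul.toIsManifold
  have : CompleteSpace E := FiniteDimensional.complete ℂ E
  let F (v w : V) (g : G) : ℂ := inner ℂ (π (τ g) v) (π g w)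
  let A : E →L[ℝ] E := realDifferential E τ (1 : G)
  have hA : HasMFDerivAt 𝓘(ℝ, E) 𝓘(ℝ, E) τ (1 : G) A := hτ.antiholomorphic.hasMFDerivAt 1
  have hAI (X : E) : A (Complex.I • X) = -(Complex.I • A X) := hτ.antiholomorphic.2 1 X
  let p (v : V) : E →L[ℂ] V := mfderiv 𝓘(ℂ, E) 𝓘(ℂ, V) (fun g => π g v) (1 : G)
  have hp (v : V) : HasMFDerivAt 𝓘(ℝ, E) 𝓘(ℝ, V) (fun g => π g v) (1 : G)
      ((p v).restrictScalars ℝ : E →L[ℝ] V) :=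
    hasMFDerivAt_restrictScalars (hπ.mdifferentiable v 1).hasMFDerivAt
  have hpτ (v : V) : HasMFDerivAt 𝓘(ℝ, E) 𝓘(ℝ, V) (fun g => π (τ g) v) (1 : G)
      (((p v).restrictScalars ℝ).comp A : E →L[ℝ] V) :=
    HasMFDerivAt.comp (1 : G) (g := fun g => π g v) (g' := ((p v).restrictScalars ℝ : E →L[ℝ] V))
      (by rw [map_one]; exact hp v) hA
  let φ := chartAt E (1 : G)
  -- `D v w` is the real differential of `F v w` at `1`. It is complex linear (`hDI`) because `A` is
  -- conjugate-linear, and it vanishes on the fixed vectors of `A` (`hfix`).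
  let D (v w : V) : E →L[ℝ] ℂ :=
    (fderivInnerCLM ℂ (v, w)).comp ((((p v).restrictScalars ℝ).comp A).prod
      ((p w).restrictScalars ℝ))
  have hD (v w : V) (X : E) : D v w X = inner ℂ v (p w X) + inner ℂ (p v (A X)) w := rfl
  have hF (v w : V) : HasMFDerivAt 𝓘(ℝ, E) 𝓘(ℝ, ℂ) (F v w) (1 : G) (D v w) := by
    rw [hasMFDerivAt_iff_hasFDerivAt_chart]
    refine ⟨(hpτ v).1.inner (𝕜 := ℂ) (hp w).1, ?_⟩
    have h1 := HasFDerivAt.inner ℂ (hasMFDerivAt_iff_hasFDerivAt_chart.1 (hpτ v)).2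
      (hasMFDerivAt_iff_hasFDerivAt_chart.1 (hp w)).2
    have h2 : φ.symm (φ 1) = 1 := φ.left_inv (mem_chart_source E 1)
    simp only [Function.comp_apply, h2, map_one, Module.End.one_apply, φ] at h1
    exact h1
  have hfix (v w : V) (X : E) (hX : A X = X) : D v w X = 0 := by
    let f : E → E := φ ∘ τ ∘ φ.symm
    have h1 : φ.symm (φ 1) = 1 := φ.left_inv (mem_chart_source E 1)
    have hmem : φ 1 ∈ φ.target := φ.map_source (mem_chart_source E 1)
    have hsymm : ContinuousAt φ.symm (φ 1) := φ.symm.continuousAt hmem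
    have hτc : ContinuousAt τ (1 : G) := hA.1
    have hsrc : ∀ᶠ y in 𝓝 (φ 1), τ (φ.symm y) ∈ φ.source := by
      have h2 : ContinuousAt (fun y => τ (φ.symm y)) (φ 1) :=
        ContinuousAt.comp (by rw [h1]; exact hτc) hsymm
      refine h2.eventually (φ.open_source.mem_nhds ?_)
      change τ (φ.symm (φ 1)) ∈ φ.source
      rw [h1, map_one]
      exact mem_chart_source E 1
    have hfc : HasStrictFDerivAt f A (φ 1) := by
      have h2 : ContDiffAt ℝ ∞ f (φ 1) := by
        have h3 := ((contMDiffAt_iff.1 (hτ.antiholomorphic.1 1)).2)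
        simp only [modelWithCornersSelf_coe, Set.range_id, contDiffWithinAt_univ] at h3
        have h4 : extChartAt 𝓘(ℝ, E) (τ 1) = extChartAt 𝓘(ℝ, E) (1 : G) := by rw [map_one]
        rw [h4] at h3
        exact h3
      have h5 := hA.2
      rw [modelWithCornersSelf_coe, Set.range_id] at h5
      unfold writtenInExtChartAt at h5
      have h4 : extChartAt 𝓘(ℝ, E) (τ 1) = extChartAt 𝓘(ℝ, E) (1 : G) := by rw [map_one]
      rw [h4] at h5
      exact h2.hasStrictFDerivAt' (hasFDerivWithinAt_univ.1 h5) (by simp)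
    obtain ⟨c, hc0, hc, hcf⟩ := exists_fixed_curve hfc (by simp [f, h1]) (by
      filter_upwards [hsrc, φ.open_target.mem_nhds hmem] with y hy hy'
      simp only [f, Function.comp_apply]
      rw [φ.left_inv hy, hτ.involutive, φ.right_inv hy']) hX
    have hder : HasDerivAt (fun t => F v w (φ.symm (c t))) (D v w X) 0 := by
      have h2 := (hasMFDerivAt_iff_hasFDerivAt_chart.1 (hF v w)).2
      exact HasFDerivAt.comp_hasDerivAt (0 : ℝ) (l := F v w ∘ φ.symm) (f := c)
        (by rw [hc0]; exact h2) hc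
    have hcz : Tendsto c (𝓝 0) (𝓝 (φ 1)) := hc0 ▸ hc.continuousAt.tendsto
    refine hder.unique ((hasDerivAt_const (0 : ℝ) (inner ℂ v w)).congr_of_eventuallyEq ?_)
    filter_upwards [hcf, hcz.eventually hsrc, hcz.eventually (φ.open_target.mem_nhds hmem)]
      with t h2 h3 h4
    have h5 : τ (φ.symm (c t)) = φ.symm (c t) := by
      have := congrArg φ.symm h2
      simp only [f, Function.comp_apply] at this
      rwa [φ.left_inv h3] at this
    simp only [F]
    rw [h5]
    exact hinv _ h5 v w
  have hAA (X : E) : A (A X) = X := by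
    have h1 := HasMFDerivAt.comp (1 : G) (g := τ) (g' := A) (by rw [map_one]; exact hA) hA
    have h2 : τ ∘ τ = id := funext hτ.involutive
    rw [h2] at h1
    exact DFunLike.congr_fun (hasMFDerivAt_unique h1 (hasMFDerivAt_id (1 : G))) X
  have hDI (v w : V) (X : E) : D v w (Complex.I • X) = Complex.I * D v w X := by
    rw [hD, hD, hAI, map_smul, map_neg, map_smul, inner_smul_right, inner_neg_left,
      inner_smul_left, Complex.conj_I]
    ring
  have hD0 (v w : V) : D v w = 0 := by
    ext X
    -- `2 X = (X + A X) - I • (I • (X - A X))`, where both `X + A X` and `I • (X - A X)` are fixed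
    -- by the conjugate-linear involution `A`.
    have h1 := hfix v w (X + A X) (by rw [map_add, hAA, add_comm])
    have h2 := hfix v w (Complex.I • (X - A X)) (by
      rw [hAI, map_sub, hAA, ← smul_neg, neg_sub])
    rw [hDI, map_sub] at h2
    rw [map_add] at h1
    have h3 := (mul_eq_zero.1 h2).resolve_left Complex.I_ne_zero
    simp only [zero_apply]
    linear_combination (h1 + h3) / 2
  have hconst (x : G) : HasMFDerivAt 𝓘(ℂ, E) 𝓘(ℂ, ℂ) (F v w) x (0 : E →L[ℂ] ℂ) := by
    have h0 : HasMFDerivAt 𝓘(ℂ, E) 𝓘(ℂ, ℂ) (F (π (τ x) v) (π x w)) (1 : G) (0 : E →L[ℂ] ℂ) := by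
      refine hasMFDerivAt_of_restrictScalars ?_
      have := hF (π (τ x) v) (π x w)
      rw [hD0] at this
      exact this
    have hs : MDifferentiableAt 𝓘(ℂ, E) 𝓘(ℂ, E) (fun y : G => y * x⁻¹) x :=
      (contMDiff_mul_right (n := ω)).mdifferentiable (by simp) x
    have h1 := HasMFDerivAt.comp x (g := F (π (τ x) v) (π x w)) (g' := (0 : E →L[ℂ] ℂ))
      (by rw [mul_inv_cancel]; exact h0) hs.hasMFDerivAt
    have h2 : F (π (τ x) v) (π x w) ∘ (fun y => y * x⁻¹) = F v w := by
      funext y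
      simp only [F, Function.comp_apply, ← Module.End.mul_apply, ← map_mul, inv_mul_cancel_right]
    rw [h2] at h1
    exact h1
  have h := eq_of_hasMFDerivAt_zero hconst g 1
  simpa [F] using h

end LieGroup

/-- `inner_involution_apply` for a positive definite form. -/
theorem IsPosDefForm.involution_apply {E : Type*} [NormedAddCommGroup E] [NormedSpace ℂ E]
    {G : Type*} [TopologicalSpace G] [ChartedSpace E G] [Group G]
    [FiniteDimensional ℂ E] [LieGroup 𝓘(ℂ, E) ω G]
    [PreconnectedSpace G] {τ : G →* G} (hτ : IsAntiholomorphicInvolution E τ)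
    {V : Type*} [AddCommGroup V] [Module ℂ V] [FiniteDimensional ℂ V]
    {π : Representation ℂ G V} (hπ : IsHolomorphicRep E π)
    {h : V →ₗ⋆[ℂ] V →ₗ[ℂ] ℂ} (hh : IsPosDefForm h) (hinv : IsInvariantForm (fixedPoints τ) π h)
    (g : G) (v w : V) : h (π (τ g) v) (π g w) = h v w := by
  let := hh.innerCore.toNormedAddCommGroup
  let := InnerProductSpace.ofCore hh.innerCore.toCore
  exact inner_involution_apply hτ hπ hinv g v w

end InnerCartan

open InnerCartan in
theorem corollary3p1
    {E : Type*} [NormedAddCommGroup E] [NormedSpace ℂ E] [FiniteDimensional ℂ E]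
    -- the connected complex Lie group
    {GC : Type*} [TopologicalSpace GC] [ChartedSpace E GC] [Group GC]
    [LieGroup 𝓘(ℂ, E) ω GC] [ConnectedSpace GC]
    -- the real form `G = GC^σ` and the compact real form `U = GC^τ`
    (σ τ : GC →* GC)
    (hσ : IsAntiholomorphicInvolution E σ) (hτ : IsAntiholomorphicInvolution E τ)
    (hU : IsCompact (fixedPoints τ : Set GC))
    (hστ : ∀ g, σ (τ g) = τ (σ g))
    -- the Cartan involution is inner
    (k₀ : GC) (hk₀ : k₀ ∈ maximalCompact σ τ)
    (hinner : ∀ X : GroupLieAlgebra 𝓘(ℂ, E) GC,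
      lieDifferential E (cartanInvolution σ τ) X = Ad E k₀ X)
    -- a finite-dimensional representation
    {V : Type*} [AddCommGroup V] [Module ℂ V] [FiniteDimensional ℂ V]
    (π : Representation ℂ GC V) (hπ : IsHolomorphicRep E π) :
    -- `T = π k₀` intertwines `π` with `π^θ`
    (∀ g : GC, π k₀ ∘ₗ π g = π (cartanInvolution σ τ g) ∘ₗ π k₀) ∧
    -- there is a nondegenerate `G`-invariant hermitian form, and it comes from `π k₀`
    ∃ B : V →ₗ⋆[ℂ] V →ₗ[ℂ] ℂ,
      IsHermitianForm B ∧ B.Nondegenerate ∧ IsInvariantForm (fixedPoints σ) π B ∧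
      ∃ (h : V →ₗ⋆[ℂ] V →ₗ[ℂ] ℂ) (S : V ≃ₗ[ℂ] V),
        IsPosDefForm h ∧ IsInvariantForm (fixedPoints τ) π h ∧
        (∀ (g : GC) (v : V), S (π g v) = π g (S v)) ∧
        (π.IsIrreducible → ∃ c : ℂ, ∀ v, S v = c • v) ∧
        ∀ v w, B v w = h (S (π k₀ v)) w := by
  have : IsTopologicalGroup GC := topologicalGroup_of_lieGroup 𝓘(ℂ, E) ω
  have hθ (g : GC) : cartanInvolution σ τ g = k₀ * g * k₀⁻¹ :=
    DFunLike.congr_fun (cartanInvolution_eq_conj hσ.antiholomorphic hτ.antiholomorphic hinner) g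
  have hintw (g : GC) (v : V) : π k₀ (π g v) = π (cartanInvolution σ τ g) (π k₀ v) := by
    rw [hθ, ← Module.End.mul_apply, ← Module.End.mul_apply, ← map_mul, ← map_mul,
      inv_mul_cancel_right]
  refine ⟨fun g => LinearMap.ext (hintw g), ?_⟩
  obtain ⟨h, hh, hhU⟩ := exists_invariant_posDefForm π (fun v l => (hπ v l).continuous)
    (fixedPoints τ) hU
  have hσk : σ k₀ = k₀ := hk₀.1
  have hτk : τ k₀ = k₀ := by
    have : τ (σ k₀) = k₀ := hk₀.2
    rwa [hσk] at this
  obtain ⟨S, hScomm, hSsymm⟩ := hh.exists_linearEquiv (π k₀) (hhU k₀ hτk)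
  have hθθ (g : GC) : cartanInvolution σ τ (cartanInvolution σ τ g) = g := by
    change τ (σ (τ (σ g))) = g
    rw [hστ, hτ.involutive, hσ.involutive]
  have hS (g : GC) (v : V) : S (π g v) = π g (S v) :=
    hScomm (π g) (fun v => by
      rw [hintw g, hintw (cartanInvolution σ τ g), hθθ]) v
  let B : V →ₗ⋆[ℂ] V →ₗ[ℂ] ℂ := h.comp ((S : V →ₗ[ℂ] V) ∘ₗ π k₀)
  have hB (v w : V) : B v w = h (S (π k₀ v)) w := rfl
  have hBherm : IsHermitianForm B := fun v w => by rw [hB, hB, hh.1, hSsymm]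
  have hsurj (v : V) : S (π k₀ (π k₀⁻¹ (S.symm v))) = v := by
    rw [← Module.End.mul_apply, ← map_mul, mul_inv_cancel, map_one, Module.End.one_apply,
      S.apply_symm_apply]
  have hzero (w : V) (hw : ∀ v, B v w = 0) : w = 0 := by
    by_contra hne
    have h1 := hh.2 w hne
    have h2 := hw (π k₀⁻¹ (S.symm w))
    rw [hB, hsurj] at h2
    simp [h2] at h1
  refine ⟨B, hBherm, ⟨fun v hv => hzero v fun w => ?_, hzero⟩, fun g hg v w => ?_, h, S, hh, hhU,
    hS, fun hirr => exists_eq_smul_of_isIrreducible hirr S hS, hB⟩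
  · rw [← hBherm, hv, map_zero]
  · have hg' : cartanInvolution σ τ g = τ g := congrArg τ hg
    rw [hB, hB, hintw, hS, hg']
    exact hh.involution_apply hτ hπ hhU g _ _
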